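/- Let $2^\omega$ be Cantor space with the fair-coin measure $\mu$. For a finite binary string $\sigma$ let $[\sigma]\subseteq 2^\omega$ be the set of infinite binary sequences extending $\sigma$. A $\Pi^0_1$ class is the set of infinite paths through a computable tree $T\subseteq 2^{<\omega}$ (a set of strings closed under prefixes); a $\Sigma^0_1$ class is a set $\bigcup_{\sigma\in W}[\sigma]$ with $W\subseteq 2^{<\omega}$ computably enumerable. A set $S\subseteq 2^\omega\times\omega$ is $\Sigma^0_1$ if there is a c.e. set $W\subseteq 2^{<\omega}\times\omega$ such that $(X,e)\in S$ iff $X\in[\sigma]$ for some $\sigma$ with $(\sigma,e)\in W$; it is $\Pi^0_1$ if its complement is $\Sigma^0_1$. A Friedberg numbering of a family $\mathcal C$ of $\Pi^0_1$ classes (respectively, of $\Sigma^0_1$ classes) is an injective map $F$ from $\omega$ onto $\mathcal C$ such that $\{(X,e): X\in F(e)\}$ is $\Pi^0_1$ (respectively, $\Sigma^0_1$). **Corollary.** The family of all $\Pi^0_1$ classes $P$ with $\mu(P)>0$ has a Friedberg numbering. Equivalently, the family of all $\Sigma^0_1$ classes $U$ with $\mu(U)<1$ has a Friedberg numbering: a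 map $e\mapsto F(e)$ is a Friedberg numbering of the first family if and only if $e\mapsto 2^\omega\setminus F(e)$ is a Friedberg numbering of the second. -/

import Mathlib

open MeasureTheory

namespace CantorClasses

/-- Cantor space `2^ω`. -/
abbrev Cantor : Type := ℕ → Bool

/-- The initial segment `X ↾ n = ⟨X 0, …, X (n - 1)⟩`. -/
def initSeg (X : Cantor) (n : ℕ) : List Bool := (List.range n).map X

/-- The cone `[σ]` of all infinite binary sequences extending `σ`. -/
def cone (σ : List Bool) : Set Cantor := {X | initSeg X σ.length = σ}

/-- The open set generated by a set of strings `W`, i.e. the union of the cones `[σ]`, `σ ∈ W`. -/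
def openClass (W : Set (List Bool)) : Set Cantor := ⋃ σ ∈ W, cone σ

/-- A tree is a set of binary strings closed under prefixes. -/
def IsTree (T : Set (List Bool)) : Prop := ∀ σ τ : List Bool, σ <+: τ → τ ∈ T → σ ∈ T

/-- The set `[T]` of infinite paths through `T`. -/
def paths (T : Set (List Bool)) : Set Cantor := {X | ∀ n : ℕ, initSeg X n ∈ T}

/-- `P` is a `Π⁰₁` class: the set of paths through a computable tree. -/
def IsPi01Class (P : Set Cantor) : Prop :=
  ∃ T : Set (List Bool), IsTree T ∧ ComputablePred (fun σ => σ ∈ T) ∧ P = paths T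

/-- `U` is a `Σ⁰₁` class: the open set generated by a c.e. set of strings. -/
def IsSigma01Class (U : Set Cantor) : Prop :=
  ∃ W : Set (List Bool), REPred (fun σ => σ ∈ W) ∧ U = openClass W

/-- `S ⊆ 2^ω × ω` is `Σ⁰₁` (effectively open): for some c.e. set `W` of pairs `(σ, e)`, we have
`(X, e) ∈ S` iff `X` extends some `σ` with `(σ, e) ∈ W`. -/
def IsSigma01Rel (S : Set (Cantor × ℕ)) : Prop :=
  ∃ W : Set (List Bool × ℕ), REPred (fun p => p ∈ W) ∧
    S = {p | ∃ σ : List Bool, (σ, p.2) ∈ W ∧ p.1 ∈ cone σ}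

/-- `S ⊆ 2^ω × ω` is `Π⁰₁` (effectively closed): its complement is `Σ⁰₁`. -/
def IsPi01Rel (S : Set (Cantor × ℕ)) : Prop := IsSigma01Rel Sᶜ

/-- `F` is a numbering of the family `𝒞` (a surjection from `ω` onto `𝒞`). -/
def IsNumbering (𝒞 : Set (Set Cantor)) (F : ℕ → Set Cantor) : Prop := Set.range F = 𝒞

/-- `F` is an effective numbering of `𝒞` with respect to the complexity `Γ`: a numbering of `𝒞`
such that the relation `X ∈ F e` has complexity `Γ`. -/
def IsEffectiveNumbering (Γ : Set (Cantor × ℕ) → Prop) (𝒞 : Set (Set Cantor))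
    (F : ℕ → Set Cantor) : Prop :=
  IsNumbering 𝒞 F ∧ Γ {p | p.1 ∈ F p.2}

/-- A Friedberg numbering is an injective effective numbering. -/
def IsFriedbergNumbering (Γ : Set (Cantor × ℕ) → Prop) (𝒞 : Set (Set Cantor))
    (F : ℕ → Set Cantor) : Prop :=
  IsEffectiveNumbering Γ 𝒞 F ∧ Function.Injective F

/-- The fair-coin measure on Cantor space: the product of the uniform measures on `{0, 1}`. -/
noncomputable def coinMeasure : Measure Cantor :=
  Measure.infinitePi (fun _ : ℕ => (PMF.uniformOfFintype Bool).toMeasure)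

/-- The family of all `Π⁰₁` classes of positive measure. -/
def positivePi01Classes : Set (Set Cantor) := {P | IsPi01Class P ∧ 0 < coinMeasure P}

/-- The family of all `Σ⁰₁` classes of measure less than one. -/
def nonfullSigma01Classes : Set (Set Cantor) := {U | IsSigma01Class U ∧ coinMeasure U < 1}

end CantorClasses

namespace CantorClasses

/-! Split the family into the cones, which all have positive measure and are listed injectively by
strings, and the remaining classes. The cones serve as a reservoir that absorbs duplicates.

The remaining classes get a uniform listing, with repetitions, by decidable trees. From a program, a
string `ρ`, a bound `n` and a level `s₀`, `guarded` follows the program's tree only while each level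
from `s₀` on is visibly good: measure at least `2⁻ⁿ`, branching at `ρ`, some extension of `ρ`
missing. At the first bad level it stops pruning, leaving a clopen class fixed by a good level.
Hence every admitted index gives a class of positive measure that is not a cone
(`coinMeasure_paths_guarded_pos`, `paths_guarded_ne_cone`), and every such `Π⁰₁` class occurs
(`exists_goodLevel`).

Repetitions are removed by guessing whether `p` is the least index of its class. A stage is
`Redundant` when the tree of `p` first agrees to some length with that of a smaller index. This
happens infinitely often if a smaller index has the same class, and finitely often otherwise
(`exists_redundant_ge`, `finite_redundant`). A follower of `p` copies the class until a redundant
stage `s`, then shrinks to a cone not yet removed, whose length codes `(p, s)`; a new follower of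
`p` starts afterwards. Only least indices keep a permanent follower, and exactly one. The cones used
by collapsed followers are dropped from the direct list of cones, so each cone also appears once
(`injOn_indexedClass`, `image_indexedClass`). -/

/-! ### Strings, cones and trees. -/

@[simp]
theorem length_initSeg (X : Cantor) (n : ℕ) : (initSeg X n).length = n := by
  simp [initSeg]

theorem getElem_initSeg (X : Cantor) (n i : ℕ) (h : i < (initSeg X n).length) :
    (initSeg X n)[i] = X i := by
  simp [initSeg]

theorem take_initSeg (X : Cantor) {k n : ℕ} (h : k ≤ n) :
    (initSeg X n).take k = initSeg X k := by
  simp [initSeg, ← List.map_take, List.take_range, h]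

theorem initSeg_eq_iff {X : Cantor} {σ : List Bool} :
    initSeg X σ.length = σ ↔ ∀ i (h : i < σ.length), X i = σ[i] := by
  constructor
  · intro h i hi
    have := getElem_initSeg X σ.length i (by simpa using hi)
    rw [← this]
    congr 1
  · intro h
    refine List.ext_getElem (by simp) fun i h1 h2 => ?_
    rw [getElem_initSeg, h i h2]

theorem mem_cone_iff_getElem {X : Cantor} {σ : List Bool} :
    X ∈ cone σ ↔ ∀ i (h : i < σ.length), X i = σ[i] := initSeg_eq_iff

theorem self_mem_cone_initSeg (X : Cantor) (n : ℕ) : X ∈ cone (initSeg X n) := by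
  simp [cone]

/-- The point extending `σ` by zeros. -/
def extendZero (σ : List Bool) : Cantor := fun i => σ.getD i false

theorem extendZero_mem_cone (σ : List Bool) : extendZero σ ∈ cone σ := by
  rw [mem_cone_iff_getElem]
  intro i h
  simp [extendZero, h]

theorem initSeg_of_mem_cone {X : Cantor} {σ : List Bool} {k : ℕ} (h : X ∈ cone σ)
    (hk : k ≤ σ.length) : initSeg X k = σ.take k := by
  have h' : initSeg X σ.length = σ := h
  rw [← take_initSeg X hk, h']

theorem mem_cone_take {X : Cantor} {σ : List Bool} (k : ℕ) (h : X ∈ cone σ) :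
    X ∈ cone (σ.take k) := by
  rw [mem_cone_iff_getElem] at h ⊢
  intro i hi
  rw [List.length_take] at hi
  rw [h i (by omega), List.getElem_take]

/-- A shorter string leaves a bit free that the longer one prescribes, so equal cones force equal
lengths; a common point then identifies the strings. -/
theorem cone_injective : Function.Injective cone := by
  have key : ∀ σ τ : List Bool, cone σ = cone τ → ¬ σ.length < τ.length := by
    intro σ τ h hlt
    have hb : (fun i => if h : i < σ.length then σ[i] else !(τ.getD i false)) ∈ cone σ := by
      rw [mem_cone_iff_getElem]
      intro i hi
      simp [hi]
    rw [h, mem_cone_iff_getElem] at hb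
    have := hb σ.length hlt
    simp [hlt] at this
  intro σ τ h
  have hl : σ.length = τ.length := by
    have h1 := key σ τ h
    have h2 := key τ σ h.symm
    omega
  have h1 : extendZero σ ∈ cone τ := h ▸ extendZero_mem_cone σ
  have h2 : initSeg (extendZero σ) σ.length = σ := extendZero_mem_cone σ
  have h3 : initSeg (extendZero σ) τ.length = τ := h1
  rw [← h2, hl, h3]

theorem mem_compl_cone_iff {X : Cantor} {τ : List Bool} :
    X ∉ cone τ ↔ ∃ σ : List Bool, (σ.length = τ.length ∧ σ ≠ τ) ∧ X ∈ cone σ := by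
  constructor
  · intro h
    exact ⟨initSeg X τ.length, ⟨by simp, h⟩, self_mem_cone_initSeg X _⟩
  · rintro ⟨σ, ⟨hl, hne⟩, hX⟩ h
    have h1 : initSeg X σ.length = σ := hX
    have h2 : initSeg X τ.length = τ := h
    exact hne (by rw [← h1, hl, h2])

/-- All binary strings of length `n`. -/
def strings (n : ℕ) : List (List Bool) :=
  Nat.rec [[]] (fun _ L => L.flatMap fun σ => [false :: σ, true :: σ]) n

theorem strings_succ (n : ℕ) :
    strings (n + 1) = (strings n).flatMap fun σ => [false :: σ, true :: σ] := rfl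

@[simp]
theorem mem_strings {n : ℕ} {σ : List Bool} : σ ∈ strings n ↔ σ.length = n := by
  induction n generalizing σ with
  | zero => simp [strings]
  | succ n ih =>
    rw [strings_succ]
    cases σ with
    | nil => simp
    | cons b σ => cases b <;> simp [ih]

theorem nodup_strings (n : ℕ) : (strings n).Nodup := by
  induction n with
  | zero => simp [strings]
  | succ n ih =>
    rw [strings_succ, List.nodup_flatMap]
    refine ⟨by simp, ih.imp fun {a b} hab => ?_⟩
    simp [Function.onFun, hab.symm]

theorem isClopen_cone (σ : List Bool) : IsClopen (cone σ) := by
  have : cone σ = ⋂ i : Fin σ.length, {X : Cantor | X i = σ[i]} := by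
    ext X
    simp only [mem_cone_iff_getElem, Set.mem_iInter, Set.mem_ofPred_eq]
    exact ⟨fun h i => h i i.2, fun h i hi => h ⟨i, hi⟩⟩
  rw [this]
  refine isClopen_iInter_of_finite fun i => ?_
  exact (isClopen_discrete {b : Bool | b = σ[i]}).preimage (continuous_apply (i : ℕ))

theorem setOf_initSeg_eq_biUnion (S : Set (List Bool)) (n : ℕ) :
    {X | initSeg X n ∈ S} = ⋃ σ ∈ {σ | σ ∈ strings n ∧ σ ∈ S}, cone σ := by
  ext X
  simp only [Set.mem_ofPred_eq, Set.mem_iUnion, mem_strings, exists_prop]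
  constructor
  · intro h
    exact ⟨initSeg X n, ⟨by simp, h⟩, self_mem_cone_initSeg X n⟩
  · rintro ⟨σ, ⟨rfl, hS⟩, hX⟩
    have : initSeg X σ.length = σ := hX
    rwa [this]

theorem isClopen_setOf_initSeg (S : Set (List Bool)) (n : ℕ) :
    IsClopen {X | initSeg X n ∈ S} := by
  rw [setOf_initSeg_eq_biUnion]
  refine Set.Finite.isClopen_biUnion ?_ fun σ _ => isClopen_cone σ
  exact (List.finite_toSet (strings n)).subset fun σ h => h.1

theorem isClosed_paths (T : Set (List Bool)) : IsClosed (paths T) := by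
  have : paths T = ⋂ n, {X | initSeg X n ∈ T} := by
    ext X
    simp [paths]
  rw [this]
  exact isClosed_iInter fun n => (isClopen_setOf_initSeg T n).1

theorem IsTree.take_mem {T : Set (List Bool)} (hT : IsTree T) {σ : List Bool} (h : σ ∈ T)
    (k : ℕ) : σ.take k ∈ T := hT _ _ (List.take_prefix k σ) h

theorem IsTree.initSeg_mem {T : Set (List Bool)} (hT : IsTree T) {X : Cantor} {k n : ℕ}
    (h : initSeg X n ∈ T) (hk : k ≤ n) : initSeg X k ∈ T := by
  rw [← take_initSeg X hk]
  exact hT.take_mem h k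

/-- König's lemma above a string. -/
theorem IsTree.exists_path {T : Set (List Bool)} (hT : IsTree T) (ρ : List Bool)
    (h : ∀ N, ∃ s ≥ N, ∃ σ ∈ T, σ.length = s ∧ σ.take ρ.length = ρ) :
    ∃ X ∈ paths T, X ∈ cone ρ := by
  have hne : (⋂ n, ({X | initSeg X n ∈ T} ∩ cone ρ)).Nonempty := by
    refine IsCompact.nonempty_iInter_of_sequence_nonempty_isCompact_isClosed _ ?_ ?_ ?_ ?_
    · rintro n X ⟨h1, h2⟩
      exact ⟨hT.initSeg_mem h1 (Nat.le_succ n), h2⟩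
    · intro n
      obtain ⟨s, hs, σ, hσ, hl, ht⟩ := h n
      refine ⟨extendZero σ, ?_, ?_⟩
      · refine hT.initSeg_mem (n := σ.length) ?_ (by omega)
        have : initSeg (extendZero σ) σ.length = σ := extendZero_mem_cone σ
        rwa [this]
      · rw [← ht]
        exact mem_cone_take _ (extendZero_mem_cone σ)
    · exact ((isClopen_setOf_initSeg T 0).1.inter (isClopen_cone ρ).1).isCompact
    · exact fun n => (isClopen_setOf_initSeg T n).1.inter (isClopen_cone ρ).1
  obtain ⟨X, hX⟩ := hne
  simp only [Set.mem_iInter] at hX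
  exact ⟨X, fun n => (hX n).1, (hX 0).2⟩

/-- By König, each string of length `r` that lies on no path has extensions in the tree only up to
some length. There are finitely many such strings, so one bound serves all. -/
theorem IsTree.eventually_take_extends {T : Set (List Bool)} (hT : IsTree T) (r : ℕ) :
    ∃ N, ∀ σ ∈ T, N ≤ σ.length → ∃ X ∈ paths T, initSeg X r = σ.take r := by
  have key : ∀ ρ : List Bool, ∃ N, ∀ σ ∈ T, N ≤ σ.length → σ.take ρ.length = ρ →
      ∃ X ∈ paths T, X ∈ cone ρ := by
    intro ρ
    by_cases h : ∀ N, ∃ s ≥ N, ∃ σ ∈ T, σ.length = s ∧ σ.take ρ.length = ρ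
    · exact ⟨0, fun _ _ _ _ => hT.exists_path ρ h⟩
    · push Not at h
      obtain ⟨N, hN⟩ := h
      exact ⟨N, fun σ hσ hl ht => absurd ht (hN _ hl σ hσ rfl)⟩
  choose f hf using key
  obtain ⟨N, hN⟩ := ((List.finite_toSet (strings r)).image f).bddAbove
  refine ⟨max N r, fun σ hσ hl => ?_⟩
  have hlr : (σ.take r).length = r := by simp; omega
  have hle : f (σ.take r) ≤ N := hN ⟨σ.take r, by simp; omega, rfl⟩
  obtain ⟨X, hX, hc⟩ := hf (σ.take r) σ hσ (by omega) (by rw [hlr])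
  refine ⟨X, hX, ?_⟩
  have h' : initSeg X (σ.take r).length = σ.take r := hc
  rwa [hlr] at h'

/-! ### The coin measure of clopen classes. -/

instance : IsProbabilityMeasure coinMeasure := by
  unfold coinMeasure
  infer_instance

theorem coinMeasure_cone (σ : List Bool) : coinMeasure (cone σ) = (2 ^ σ.length)⁻¹ := by
  have : cone σ = Set.pi (Finset.range σ.length) (fun i => {σ.getD i false}) := by
    ext X
    rw [mem_cone_iff_getElem]
    simp only [Set.mem_pi, Finset.coe_range, Set.mem_Iio, Set.mem_singleton_iff]
    refine forall_congr' fun i => forall_congr' fun hi => ?_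
    simp [hi]
  rw [this, coinMeasure, Measure.infinitePi_pi _ (fun _ _ => measurableSet_singleton _)]
  have h2 : ∀ i ∈ Finset.range σ.length,
      (PMF.uniformOfFintype Bool).toMeasure {σ.getD i false} = 2⁻¹ := by
    intro i _
    rw [PMF.toMeasure_apply_singleton _ _ (measurableSet_singleton _)]
    simp
  rw [Finset.prod_congr rfl h2]
  simp [ENNReal.inv_pow]

open Classical in
theorem coinMeasure_setOf_initSeg (S : Set (List Bool)) (n : ℕ) :
    coinMeasure {X | initSeg X n ∈ S} =
      (((strings n).filter (· ∈ S)).length : ENNReal) * (2 ^ n)⁻¹ := by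
  have h1 : {X | initSeg X n ∈ S} =
      ⋃ σ ∈ ((strings n).filter (· ∈ S)).toFinset, cone σ := by
    rw [setOf_initSeg_eq_biUnion]
    simp
  rw [h1, measure_biUnion_finset]
  · have : ∀ σ ∈ ((strings n).filter (· ∈ S)).toFinset, coinMeasure (cone σ) = (2 ^ n)⁻¹ := by
      intro σ hσ
      simp only [List.mem_toFinset, List.mem_filter, mem_strings] at hσ
      rw [coinMeasure_cone, hσ.1]
    rw [Finset.sum_congr rfl this, Finset.sum_const, nsmul_eq_mul,
      List.toFinset_card_of_nodup ((nodup_strings n).filter _)]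
  · intro σ hσ τ hτ hne
    simp only [List.coe_toFinset, List.mem_filter, mem_strings, Set.mem_ofPred_eq] at hσ hτ
    refine Set.disjoint_left.2 fun X h1 h2 => hne ?_
    have h1 : initSeg X σ.length = σ := h1
    have h2 : initSeg X τ.length = τ := h2
    rw [← h1, hσ.1, ← hτ.1, h2]
  · exact fun σ _ => (isClopen_cone σ).1.measurableSet

-- Clearing denominators turns the measure bound into a count of strings, which can be decided level
-- by level.
open Classical in
theorem inv_two_pow_le_coinMeasure_iff (S : Set (List Bool)) (m n : ℕ) :
    ((2 : ENNReal) ^ m)⁻¹ ≤ coinMeasure {X | initSeg X n ∈ S} ↔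
      2 ^ n ≤ 2 ^ m * ((strings n).filter (· ∈ S)).length := by
  rw [coinMeasure_setOf_initSeg, ← div_eq_mul_inv, ENNReal.le_div_iff_mul_le (by simp) (by simp),
    mul_comm, ← div_eq_mul_inv, ENNReal.div_le_iff_le_mul (by simp) (by simp), mul_comm]
  norm_cast

/-! ### Closure properties of primitive recursive and c.e. predicates. -/

section Computability

variable {α β : Type*} [Primcodable α] [Primcodable β]

theorem primrecPred_imp {p q : α → Prop} (hp : PrimrecPred p) (hq : PrimrecPred q) :
    PrimrecPred fun a => p a → q a :=
  (hp.not.or hq).of_eq fun _ => imp_iff_not_or.symm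

theorem primrecPred_forall_mem {f : α → List β} (hf : Primrec f) {P : α → β → Prop}
    (hP : PrimrecPred fun q : α × β => P q.1 q.2) : PrimrecPred fun a => ∀ b ∈ f a, P a b := by
  have h : PrimrecRel fun (b : β) (a : α) => P a b :=
    hP.comp (f := fun q : β × α => (q.2, q.1)) (Primrec.snd.pair Primrec.fst)
  exact h.forall_mem_list.comp hf Primrec.id

theorem primrecPred_exists_mem {f : α → List β} (hf : Primrec f) {P : α → β → Prop}
    (hP : PrimrecPred fun q : α × β => P q.1 q.2) : PrimrecPred fun a => ∃ b ∈ f a, P a b := by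
  have h : PrimrecRel fun (b : β) (a : α) => P a b :=
    hP.comp (f := fun q : β × α => (q.2, q.1)) (Primrec.snd.pair Primrec.fst)
  exact h.exists_mem_list.comp hf Primrec.id

theorem primrecPred_forall_lt {f : α → ℕ} (hf : Primrec f) {P : α → ℕ → Prop}
    (hP : PrimrecPred fun q : α × ℕ => P q.1 q.2) : PrimrecPred fun a => ∀ n < f a, P a n :=
  (primrecPred_forall_mem (Primrec.list_range.comp hf) hP).of_eq fun a => by simp

theorem primrecPred_exists_lt {f : α → ℕ} (hf : Primrec f) {P : α → ℕ → Prop}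
    (hP : PrimrecPred fun q : α × ℕ => P q.1 q.2) : PrimrecPred fun a => ∃ n < f a, P a n :=
  (primrecPred_exists_mem (Primrec.list_range.comp hf) hP).of_eq fun a => by simp

theorem primrec_filter {f : α → List β} (hf : Primrec f) {P : α → β → Prop}
    [∀ a, DecidablePred (P a)] (hP : PrimrecPred fun q : α × β => P q.1 q.2) :
    Primrec fun a => (f a).filter (P a ·) := by
  have h : PrimrecRel fun (b : β) (a : α) => P a b :=
    hP.comp (f := fun q : β × α => (q.2, q.1)) (Primrec.snd.pair Primrec.fst)
  have : DecidableRel fun (b : β) (a : α) => P a b := fun b a => inferInstance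
  exact (h.listFilter.comp hf Primrec.id).of_eq fun a => List.filter_congr fun b _ => by simp

theorem primrec_strings : Primrec strings := by
  refine Primrec.nat_rec₁ _ ?_
  have hc : ∀ b : Bool, Primrec fun q : (ℕ × List (List Bool)) × List Bool => b :: q.2 :=
    fun b => Primrec.list_cons.comp (Primrec.const b) Primrec.snd
  exact Primrec.list_flatMap Primrec.snd
    (Primrec.list_cons.comp (hc false) (Primrec.list_cons.comp (hc true) (Primrec.const [])))

theorem primrec_replicate_false : Primrec fun n : ℕ => List.replicate n false :=
  (Primrec.list_map Primrec.list_range (Primrec.const false).to₂).of_eq fun n => by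
    simp

theorem primrec_two_pow : Primrec fun n : ℕ => 2 ^ n :=
  (Primrec.nat_rec₁ 1 (Primrec.nat_mul.comp (Primrec.const 2) Primrec.snd).to₂).of_eq fun n => by
    induction n with
    | zero => rfl
    | succ n ih => rw [pow_succ', ← ih]

theorem primrec_count {p : ℕ → Prop} [DecidablePred p] (hp : PrimrecPred p) :
    Primrec (Nat.count p) :=
  (Primrec.list_length.comp (primrec_filter Primrec.list_range
    (P := fun _ n => p n) (hp.comp Primrec.snd))).of_eq fun n => by
      rw [Nat.count_eq_card_filter_range]
      rw [← List.toFinset_card_of_nodup (List.nodup_range.filter _)]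
      congr 1
      ext
      simp

theorem rePred_exists {P : α → ℕ → Prop} (hP : PrimrecPred fun q : α × ℕ => P q.1 q.2) :
    REPred fun a => ∃ n, P a n := by
  classical
  have h : Partrec fun a => Nat.rfind fun n => Part.some (decide (P a n)) :=
    Partrec.rfind hP.computablePred.decide.partrec
  exact h.dom_re.of_eq fun a => Nat.rfind_dom.trans (by simp)

theorem rePred_comp {p : β → Prop} (hp : REPred p) {f : α → β} (hf : Computable f) :
    REPred fun a => p (f a) :=
  Partrec.comp hp hf

end Computability

/-! ### Computable trees for effectively closed classes, and renumbering. -/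

/-- The computable tree whose paths avoid the open set enumerated by the program `c`. -/
def codeTree (c : Nat.Partrec.Code) : Set (List Bool) :=
  {σ | ∀ k < σ.length + 1, Nat.Partrec.Code.evaln σ.length c (Encodable.encode (σ.take k)) = none}

theorem primrecPred_codeTree :
    PrimrecPred fun q : Nat.Partrec.Code × List Bool => q.2 ∈ codeTree q.1 := by
  refine primrecPred_forall_lt (Primrec.succ.comp (Primrec.list_length.comp Primrec.snd)) ?_
  refine Primrec.eq.comp ?_ (Primrec.const none)
  exact Nat.Partrec.Code.primrec_evaln.comp
    (((Primrec.list_length.comp (Primrec.snd.comp Primrec.fst)).pair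
      (Primrec.fst.comp Primrec.fst)).pair
      (Primrec.encode.comp (Primrec.list_take.comp Primrec.snd (Primrec.snd.comp Primrec.fst))))

theorem isTree_codeTree (c : Nat.Partrec.Code) : IsTree (codeTree c) := by
  intro σ τ h hτ k hk
  have hl : σ.length ≤ τ.length := h.length_le
  have ht : σ.take k = τ.take k := by
    rw [List.prefix_iff_eq_take.1 h, List.take_take, min_eq_left (by omega)]
  rw [ht]
  by_contra hne
  obtain ⟨x, hx⟩ := Option.ne_none_iff_exists'.1 hne
  have h2 := Nat.Partrec.Code.evaln_mono hl hx
  rw [hτ k (by omega)] at h2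
  simp at h2

/-- At a node `σ` the program gets only `σ.length` steps on each prefix, which keeps the tree
decidable. A prefix that is enumerated late still kills every path through it, at a deeper level. -/
theorem exists_paths_codeTree_eq {U : Set Cantor} (hU : IsSigma01Class U) :
    ∃ c, Uᶜ = paths (codeTree c) := by
  obtain ⟨W, hW, rfl⟩ := hU
  obtain ⟨c, hc⟩ := Nat.Partrec.Code.exists_code.1 hW
  have hdom : ∀ σ, (∃ k x, x ∈ Nat.Partrec.Code.evaln k c (Encodable.encode σ)) ↔ σ ∈ W := by
    intro σ
    rw [exists_comm]
    simp_rw [← Nat.Partrec.Code.evaln_complete, hc]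
    simp [Part.mem_assert_iff]
  refine ⟨c, ?_⟩
  ext X
  simp only [openClass, Set.mem_compl_iff, Set.mem_iUnion, not_exists, paths]
  constructor
  · intro h n k hk
    by_contra hne
    obtain ⟨x, hx⟩ := Option.ne_none_iff_exists'.1 hne
    refine h _ ((hdom _).1 ⟨_, x, hx⟩) ?_
    rw [length_initSeg] at hk
    rw [take_initSeg X (by omega)]
    exact self_mem_cone_initSeg X k
  · intro h σ hσ hX
    obtain ⟨k, x, hx⟩ := (hdom σ).2 hσ
    have h1 := h (max k σ.length) σ.length (by simp)
    have h2 : initSeg X σ.length = σ := hX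
    rw [take_initSeg X (le_max_right _ _), h2, length_initSeg] at h1
    have h3 := Nat.Partrec.Code.evaln_mono (le_max_left k σ.length) hx
    rw [h1] at h3
    simp at h3

theorem compl_paths (T : Set (List Bool)) : (paths T)ᶜ = openClass Tᶜ := by
  ext X
  simp only [paths, openClass, Set.mem_compl_iff, Set.mem_iUnion, Set.mem_ofPred_eq, not_forall]
  constructor
  · rintro ⟨n, hn⟩
    exact ⟨_, hn, self_mem_cone_initSeg X n⟩
  · rintro ⟨σ, hσ, hX⟩
    refine ⟨σ.length, ?_⟩
    have h2 : initSeg X σ.length = σ := hX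
    rwa [h2]

theorem isPi01Class_iff_compl {P : Set Cantor} : IsPi01Class P ↔ IsSigma01Class Pᶜ := by
  constructor
  · rintro ⟨T, -, hT, rfl⟩
    exact ⟨Tᶜ, hT.not.to_re, compl_paths T⟩
  · intro h
    obtain ⟨c, hc⟩ := exists_paths_codeTree_eq h
    rw [compl_compl] at hc
    refine ⟨codeTree c, isTree_codeTree c, ?_, hc⟩
    exact (primrecPred_codeTree.comp ((Primrec.const c).pair Primrec.id)).computablePred

theorem isSigma01Class_of_rel {S : Set (Cantor × ℕ)} (hS : IsSigma01Rel S) (e : ℕ) :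
    IsSigma01Class {X | (X, e) ∈ S} := by
  obtain ⟨W, hW, rfl⟩ := hS
  refine ⟨{σ | (σ, e) ∈ W}, rePred_comp hW (Computable.id.pair (Computable.const e)), ?_⟩
  ext X
  simp [openClass]

theorem isPi01Class_of_rel {F : ℕ → Set Cantor} (hF : IsPi01Rel {p | p.1 ∈ F p.2}) (e : ℕ) :
    IsPi01Class (F e) :=
  isPi01Class_iff_compl.2 (isSigma01Class_of_rel hF e)

/-- A uniformly `Π⁰₁` family over an infinite decidable set of indices, without repetitions,
can be renumbered injectively by `ℕ`. -/
theorem exists_renumbering {J : Type*} [Primcodable J] {I : Set J}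
    (hI : PrimrecPred fun j => j ∈ I) (hinf : I.Infinite) {F : J → Set Cantor}
    (hF : Set.InjOn F I) {W : List Bool → J → Prop}
    (hW : PrimrecPred fun q : List Bool × J => W q.1 q.2)
    (hFW : ∀ j ∈ I, ∀ X, X ∉ F j ↔ ∃ σ, W σ j ∧ X ∈ cone σ) :
    ∃ G : ℕ → Set Cantor, Function.Injective G ∧ Set.range G = F '' I ∧
      IsPi01Rel {p | p.1 ∈ G p.2} := by
  classical
  -- `decode₂` accepts only the actual code of an element, so each index is met at exactly one
  -- number and the listing below stays injective.
  set d : ℕ → List J := fun m => (Encodable.decode₂ J m).toList with hd_def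
  have hd : Primrec d := Primrec.optionToList.comp Primrec.decode₂
  have hmem : ∀ {m j}, j ∈ d m ↔ Encodable.encode j = m := by
    intro m j
    rw [← Encodable.mem_decode₂]
    simp [hd_def]
  set p : ℕ → Prop := fun m => ∃ j ∈ d m, j ∈ I with hp_def
  have hp : PrimrecPred p :=
    primrecPred_exists_mem hd (P := fun _ j => j ∈ I) (hI.comp Primrec.snd)
  have hpenc : ∀ {j}, j ∈ I → p (Encodable.encode j) := fun hj => ⟨_, hmem.2 rfl, hj⟩
  have hpinf : (Set.ofPred p).Infinite := by
    refine (hinf.image (f := Encodable.encode) Encodable.encode_injective.injOn).mono ?_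
    rintro _ ⟨j, hj, rfl⟩
    exact hpenc hj
  choose g hgd hgI using fun n => Nat.nth_mem_of_infinite (p := p) hpinf n
  have hg : ∀ n, Encodable.encode (g n) = Nat.nth p n := fun n => hmem.1 (hgd n)
  refine ⟨fun n => F (g n), ?_, ?_, ?_⟩
  · intro m n h
    have h1 := hF (hgI m) (hgI n) h
    refine Nat.nth_injective hpinf ?_
    rw [← hg, ← hg, h1]
  · ext P
    constructor
    · rintro ⟨n, rfl⟩
      exact ⟨_, hgI n, rfl⟩
    · rintro ⟨j, hj, rfl⟩
      refine ⟨Nat.count p (Encodable.encode j), congrArg F (Encodable.encode_injective ?_)⟩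
      rw [hg, Nat.nth_count (hpenc hj)]
  -- The `n`th code is described as the valid `m` with `n` valid codes below it, a decidable
  -- condition on `m`.
  · refine ⟨{q | ∃ m, (p m ∧ Nat.count p m = q.2) ∧ ∃ j ∈ d m, W q.1 j}, ?_, ?_⟩
    · refine rePred_exists (P := fun (q : List Bool × ℕ) m =>
        (p m ∧ Nat.count p m = q.2) ∧ ∃ j ∈ d m, W q.1 j) ?_
      refine ((hp.comp Primrec.snd).and ?_).and ?_
      · exact Primrec.eq.comp ((primrec_count hp).comp Primrec.snd)
          (Primrec.snd.comp Primrec.fst)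
      · exact primrecPred_exists_mem (hd.comp Primrec.snd)
          (P := fun (q : (List Bool × ℕ) × ℕ) j => W q.1.1 j)
          (hW.comp ((Primrec.fst.comp (Primrec.fst.comp Primrec.fst)).pair Primrec.snd))
    · ext ⟨X, n⟩
      change X ∉ F _ ↔ _
      rw [hFW _ (hgI n)]
      constructor
      · rintro ⟨σ, hσ, hX⟩
        exact ⟨σ, ⟨_, ⟨⟨g n, hgd n, hgI n⟩, Nat.count_nth_of_infinite hpinf n⟩,
          g n, hgd n, hσ⟩, hX⟩
      · rintro ⟨σ, ⟨m, ⟨hm, rfl⟩, j, hj, hσ⟩, hX⟩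
        have : g (Nat.count p m) = j := Encodable.encode_injective (by
          rw [hg, Nat.nth_count hm, hmem.1 hj])
        exact ⟨σ, this ▸ hσ, hX⟩

/-! ### Removing repetitions with the cones as a reservoir. -/

section Kummer

variable (V : ℕ → Set (List Bool))

/-- At stage `s`, every string of `S` extends to length `r` as some string of `T` does. -/
def StageLE (S T : Set (List Bool)) (r s : ℕ) : Prop :=
  ∀ σ ∈ strings s, σ ∈ S → ∃ τ ∈ strings s, τ ∈ T ∧ τ.take r = σ.take r

/-- The trees `S` and `T` look alike up to length `r` at stage `s`. -/
def Agree (S T : Set (List Bool)) (r s : ℕ) : Prop :=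
  r ≤ s ∧ StageLE S T r s ∧ StageLE T S r s

/-- At deep levels the surviving restrictions to length `r` are exactly those of paths, and both
trees have the same paths. -/
theorem eventually_agree {S T : Set (List Bool)} (hS : IsTree S) (hT : IsTree T)
    (h : paths S = paths T) (r : ℕ) : ∃ s, Agree S T r s := by
  have key : ∀ {S T : Set (List Bool)}, IsTree S → paths S = paths T →
      ∃ N, ∀ s ≥ N, r ≤ s → StageLE S T r s := by
    intro S T hS h
    obtain ⟨N, hN⟩ := hS.eventually_take_extends r
    refine ⟨N, fun s hs hr σ hl hσ => ?_⟩
    rw [mem_strings] at hl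
    obtain ⟨X, hX, hXr⟩ := hN σ hσ (by omega)
    rw [h] at hX
    exact ⟨initSeg X s, by simp, hX s, by rw [take_initSeg X hr, hXr]⟩
  obtain ⟨N, hN⟩ := key hS h
  obtain ⟨M, hM⟩ := key hT h.symm
  exact ⟨r + N + M, by omega, hN _ (by omega) (by omega), hM _ (by omega) (by omega)⟩

/-- A path of one tree that leaves the other at length `r₀` witnesses disagreement at every `r ≥
r₀`, uniformly in the stage. -/
theorem eventually_not_agree {S T : Set (List Bool)} (hS : IsTree S) (hT : IsTree T)
    (h : paths S ≠ paths T) : ∃ r₀, ∀ r ≥ r₀, ∀ s, ¬ Agree S T r s := by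
  have key : ∀ {S T : Set (List Bool)}, IsTree T → ¬ paths S ⊆ paths T →
      ∃ r₀, ∀ r ≥ r₀, ∀ s, r ≤ s → ¬ StageLE S T r s := by
    intro S T hT h
    obtain ⟨X, hXS, hXT⟩ := Set.not_subset.1 h
    obtain ⟨r₀, hr₀⟩ : ∃ n, initSeg X n ∉ T := by simpa [paths] using hXT
    refine ⟨r₀, fun r hr s hs hle => ?_⟩
    obtain ⟨τ, -, hτ, ht⟩ := hle (initSeg X s) (by simp) (hXS s)
    rw [take_initSeg X hs] at ht
    have := hT.take_mem hτ r
    rw [ht] at this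
    exact hr₀ (hT.initSeg_mem this hr)
  rw [Ne, Set.Subset.antisymm_iff, not_and_or] at h
  rcases h with h | h
  · obtain ⟨r₀, hr⟩ := key hT h
    exact ⟨r₀, fun r hr0 s ha => hr r hr0 s ha.1 ha.2.1⟩
  · obtain ⟨r₀, hr⟩ := key hS h
    exact ⟨r₀, fun r hr0 s ha => hr r hr0 s ha.1 ha.2.2⟩

variable (A : Set ℕ)

/-- Stage `s` gives new evidence that the class with index `p` has a smaller index in `A`. -/
def Redundant (p s : ℕ) : Prop :=
  ∃ i < p, i ∈ A ∧ ∃ r < s + 1, Agree (V p) (V i) r s ∧ ∀ s' < s, ¬ Agree (V p) (V i) r s'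

theorem exists_redundant_ge (hV : ∀ p, IsTree (V p)) {p i : ℕ} (hi : i < p) (hiA : i ∈ A)
    (h : paths (V p) = paths (V i)) (N : ℕ) : ∃ s ≥ N, Redundant V A p s := by
  classical
  -- Agreement to length `N` requires a stage at least `N`, so its first occurrence is a redundant
  -- stage as late as desired.
  have hex := eventually_agree (hV p) (hV i) h N
  have hle : N ≤ Nat.find hex := (Nat.find_spec hex).1
  exact ⟨Nat.find hex, hle, i, hi, hiA, N, by omega, Nat.find_spec hex,
    fun s' hs' => Nat.find_min hex hs'⟩

/-- Each pair `(i, r)` contributes at most one stage, its first agreement. For each of the finitely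
many `i < p` in `A`, only finitely many `r` ever agree. -/
theorem finite_redundant (hV : ∀ p, IsTree (V p)) {p : ℕ}
    (h : ∀ i < p, i ∈ A → paths (V p) ≠ paths (V i)) : {s | Redundant V A p s}.Finite := by
  have h' : ∀ i, ∃ r₀, i < p → i ∈ A → ∀ r ≥ r₀, ∀ s, ¬ Agree (V p) (V i) r s := by
    intro i
    by_cases hi : i < p ∧ i ∈ A
    · obtain ⟨r₀, hr⟩ := eventually_not_agree (hV p) (hV i) (h i hi.1 hi.2)
      exact ⟨r₀, fun _ _ => hr⟩
    · exact ⟨0, fun h1 h2 => absurd ⟨h1, h2⟩ hi⟩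
  choose f hf using h'
  refine Set.Finite.subset (s := ⋃ i ∈ Set.Iio p, ⋃ r ∈ Set.Iio (f i),
    {s | Agree (V p) (V i) r s ∧ ∀ s' < s, ¬ Agree (V p) (V i) r s'}) ?_ ?_
  · refine (Set.finite_Iio p).biUnion fun i _ => (Set.finite_Iio (f i)).biUnion fun r _ => ?_
    refine Set.Subsingleton.finite fun a ha b hb => ?_
    rcases lt_trichotomy a b with hab | hab | hab
    · exact absurd ha.1 (hb.2 a hab)
    · exact hab
    · exact absurd hb.1 (ha.2 b hab)
  · rintro s ⟨i, hi, hiA, r, -, hag, hfirst⟩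
    simp only [Set.mem_iUnion]
    refine ⟨i, hi, r, ?_, hag, hfirst⟩
    by_contra hr
    exact hf i hi hiA r (not_lt.1 hr) s hag

/-- `s` is the first redundant stage of `p` from `t` on. -/
def FirstRedundant (p t s : ℕ) : Prop :=
  t ≤ s ∧ Redundant V A p s ∧ ∀ s' < s, t ≤ s' → ¬ Redundant V A p s'

variable {V A} in
theorem FirstRedundant.unique {p t s s' : ℕ} (h : FirstRedundant V A p t s)
    (h' : FirstRedundant V A p t s') : s = s' := by
  rcases lt_trichotomy s s' with hab | hab | hab
  · exact absurd h.2.1 (h'.2.2 s hab h.1)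
  · exact hab
  · exact absurd h'.2.1 (h.2.2 s' hab h'.1)

theorem exists_firstRedundant {p t s : ℕ} (hs : t ≤ s) (h : Redundant V A p s) :
    ∃ s, FirstRedundant V A p t s := by
  classical
  have hex : ∃ s, t ≤ s ∧ Redundant V A p s := ⟨s, hs, h⟩
  exact ⟨Nat.find hex, (Nat.find_spec hex).1, (Nat.find_spec hex).2,
    fun s' hs' ht hr => Nat.find_min hex hs' ⟨ht, hr⟩⟩

open Classical in
/-- A string extending a string of length `s` in `V p`, whose length codes `(p, s)`. -/
noncomputable def target (p s : ℕ) : List Bool :=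
  (((strings s).filter (· ∈ V p)).head?.getD []) ++ List.replicate (Nat.pair p s - s) false

/-- A path supplies a string at level `s`, so the default `[]` is never used. Since `s ≤ Nat.pair p
s`, the zero padding reaches the coding length exactly. -/
theorem target_spec (p s : ℕ) (h : (paths (V p)).Nonempty) :
    (target V p s).take s ∈ V p ∧ (target V p s).length = Nat.pair p s := by
  classical
  obtain ⟨X, hX⟩ := h
  have hmem : initSeg X s ∈ (strings s).filter (· ∈ V p) := by
    simpa using hX s
  obtain ⟨σ, l, hl⟩ := List.exists_cons_of_ne_nil (List.ne_nil_of_mem hmem)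
  have hσ : σ ∈ (strings s).filter (· ∈ V p) := by rw [hl]; simp
  simp only [List.mem_filter, mem_strings, decide_eq_true_eq] at hσ
  have ht : target V p s = σ ++ List.replicate (Nat.pair p s - s) false := by
    simp only [target, hl, List.head?_cons, Option.getD_some]
  rw [ht]
  constructor
  · rw [← hσ.1, List.take_left]
    exact hσ.2
  · have := Nat.right_le_pair p s
    simp [hσ.1, this]

/-- The class followed by the index `(p, t)`: it is that of `V p`, until a redundant stage from `t`
on makes it a cone. -/
def follower (p t : ℕ) : Set Cantor :=
  {X | (∃ s, FirstRedundant V A p t s ∧ X ∈ cone (target V p s)) ∨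
    ((∀ s ≥ t, ¬ Redundant V A p s) ∧ X ∈ paths (V p))}

theorem follower_of_firstRedundant {p t s : ℕ} (h : FirstRedundant V A p t s) :
    follower V A p t = cone (target V p s) := by
  ext X
  constructor
  · rintro (⟨s', h', hX⟩ | ⟨h', -⟩)
    · rwa [h.unique h']
    · exact absurd h.2.1 (h' s h.1)
  · exact fun hX => Or.inl ⟨s, h, hX⟩

theorem follower_of_forall_not {p t : ℕ} (h : ∀ s ≥ t, ¬ Redundant V A p s) :
    follower V A p t = paths (V p) := by
  ext X
  constructor
  · rintro (⟨s', h', -⟩ | ⟨-, hX⟩)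
    · exact absurd h'.2.1 (h s' h'.1)
    · exact hX
  · exact fun hX => Or.inr ⟨h, hX⟩

/-- The index set of the injective numbering. -/
def indexSet : Set (ℕ × ℕ ⊕ List Bool) :=
  {j | j.elim (fun q => q.1 ∈ A ∧ (q.2 = 0 ∨ Redundant V A q.1 (q.2 - 1)))
    (fun τ => ¬ (τ.length.unpair.1 ∈ A ∧ Redundant V A τ.length.unpair.1 τ.length.unpair.2 ∧
      τ = target V τ.length.unpair.1 τ.length.unpair.2))}

/-- The classes of the injective numbering. -/
def indexedClass : ℕ × ℕ ⊕ List Bool → Set Cantor :=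
  Sum.elim (fun q => follower V A q.1 q.2) cone

variable {V A}

/-- A follower is born only at `0` or right after a redundant stage, and that stage has already
collapsed every earlier follower of `p`. -/
theorem birth_unique {p t t' : ℕ} (ht : t' = 0 ∨ Redundant V A p (t' - 1)) (hlt : t < t') {s : ℕ}
    (h : FirstRedundant V A p t s) (hs : t' ≤ s) : False := by
  rcases ht with ht | ht
  · omega
  · exact h.2.2 (t' - 1) (by omega) (by omega) ht

/-- Collapsed followers are separated by the lengths of their cones, and from the listed cones by
the exclusion in `indexSet`. Permanent followers carry classes that are not cones, so only two
permanent followers of the same class need an argument. -/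
theorem injOn_indexedClass (hV : ∀ p, IsTree (V p)) (hne : ∀ p ∈ A, (paths (V p)).Nonempty)
    (hcone : ∀ p ∈ A, ∀ τ, paths (V p) ≠ cone τ) :
    Set.InjOn (indexedClass V A) (indexSet V A) := by
  have hcases : ∀ p t, (∃ s, FirstRedundant V A p t s) ∨ ∀ s ≥ t, ¬ Redundant V A p s := by
    intro p t
    by_cases h : ∀ s ≥ t, ¬ Redundant V A p s
    · exact Or.inr h
    · push Not at h
      obtain ⟨s, hs, hr⟩ := h
      exact Or.inl (exists_firstRedundant V A hs hr)
  have hmixed : ∀ p t τ, (Sum.inl (p, t)) ∈ indexSet V A → (Sum.inr τ) ∈ indexSet V A →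
      follower V A p t ≠ cone τ := by
    rintro p t τ ⟨hp, -⟩ hτ heq
    rcases hcases p t with ⟨s, hs⟩ | hs
    · rw [follower_of_firstRedundant V A hs] at heq
      have h1 := cone_injective heq
      apply hτ
      rw [← h1, (target_spec V p s (hne p hp)).2, Nat.unpair_pair]
      exact ⟨hp, hs.2.1, rfl⟩
    · rw [follower_of_forall_not V A hs] at heq
      exact hcone p hp τ heq
  have hfol : ∀ p t p' t', (Sum.inl (p, t)) ∈ indexSet V A → (Sum.inl (p', t')) ∈ indexSet V A →
      follower V A p t = follower V A p' t' → p = p' ∧ ¬ t < t' := by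
    rintro p t p' t' ⟨hp, -⟩ ⟨hp', ht'⟩ heq
    rcases hcases p t with ⟨s, hs⟩ | hs <;> rcases hcases p' t' with ⟨s', hs'⟩ | hs'
    · rw [follower_of_firstRedundant V A hs, follower_of_firstRedundant V A hs'] at heq
      have h1 := congrArg List.length (cone_injective heq)
      rw [(target_spec V p s (hne p hp)).2, (target_spec V p' s' (hne p' hp')).2,
        Nat.pair_eq_pair] at h1
      obtain ⟨rfl, rfl⟩ := h1
      exact ⟨rfl, fun hlt => birth_unique ht' hlt hs hs'.1⟩
    · rw [follower_of_firstRedundant V A hs, follower_of_forall_not V A hs'] at heq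
      exact absurd heq.symm (hcone p' hp' _)
    · rw [follower_of_forall_not V A hs, follower_of_firstRedundant V A hs'] at heq
      exact absurd heq (hcone p hp _)
    · rw [follower_of_forall_not V A hs, follower_of_forall_not V A hs'] at heq
      -- The larger of two indices of one class is redundant arbitrarily late, so it has no
      -- permanent follower.
      have hpp : p = p' := by
        rcases lt_trichotomy p p' with hlt | hlt | hlt
        · obtain ⟨s, hs1, hs2⟩ := exists_redundant_ge V A hV hlt hp heq.symm t'
          exact absurd hs2 (hs' s hs1)
        · exact hlt
        · obtain ⟨s, hs1, hs2⟩ := exists_redundant_ge V A hV hlt hp' heq t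
          exact absurd hs2 (hs s hs1)
      subst hpp
      refine ⟨rfl, fun hlt => ?_⟩
      rcases ht' with ht' | ht'
      · simp only at ht'
        omega
      · simp only at ht'
        exact hs _ (by omega) ht'
  rintro (⟨p, t⟩ | τ) hj (⟨p', t'⟩ | τ') hj' heq
  · obtain ⟨rfl, h1⟩ := hfol p t p' t' hj hj' heq
    have h2 := (hfol p t' p t hj' hj heq.symm).2
    have : t = t' := by omega
    rw [this]
  · exact absurd heq (hmixed p t τ' hj hj')
  · exact absurd heq.symm (hmixed p' t' τ hj' hj)
  · rw [cone_injective heq]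

theorem image_indexedClass (hV : ∀ p, IsTree (V p)) :
    indexedClass V A '' indexSet V A = Set.range cone ∪ (fun p => paths (V p)) '' A := by
  -- The latest birth up to `b` gives the follower of `p` alive at stage `b`.
  have hbirth : ∀ p b, ∃ t ≤ b, (t = 0 ∨ Redundant V A p (t - 1)) ∧
      ∀ s < b, t ≤ s → ¬ Redundant V A p s := by
    intro p b
    induction b with
    | zero => exact ⟨0, le_rfl, Or.inl rfl, by simp⟩
    | succ b ih =>
      by_cases hr : Redundant V A p b
      · exact ⟨b + 1, le_rfl, Or.inr (by simpa using hr), fun s h1 h2 => by omega⟩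
      · obtain ⟨t, htb, ht, hs⟩ := ih
        refine ⟨t, by omega, ht, fun s hsb hts => ?_⟩
        rcases Nat.lt_succ_iff_lt_or_eq.1 hsb with h | rfl
        · exact hs s h hts
        · exact hr
  ext P
  constructor
  · rintro ⟨⟨p, t⟩ | τ, hj, rfl⟩
    · by_cases h : ∀ s ≥ t, ¬ Redundant V A p s
      · exact Or.inr ⟨p, hj.1, (follower_of_forall_not V A h).symm⟩
      · push Not at h
        obtain ⟨s, hs, hr⟩ := h
        obtain ⟨s', hs'⟩ := exists_firstRedundant V A hs hr
        exact Or.inl ⟨_, (follower_of_firstRedundant V A hs').symm⟩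
    · exact Or.inl ⟨τ, rfl⟩
  · rintro (⟨τ, rfl⟩ | ⟨p, hp, rfl⟩)
    · by_cases hτ : Sum.inr τ ∈ indexSet V A
      · exact ⟨_, hτ, rfl⟩
      -- An excluded cone is the target of a redundant stage; the follower alive at that stage
      -- collapses onto it.
      · obtain ⟨hp, hr, heq⟩ := not_not.1 hτ
        generalize τ.length.unpair.1 = p at *
        generalize τ.length.unpair.2 = s at *
        obtain ⟨t, hts, ht, hfirst⟩ := hbirth p s
        refine ⟨Sum.inl (p, t), ⟨hp, ht⟩, ?_⟩
        rw [heq]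
        exact follower_of_firstRedundant V A ⟨hts, hr, hfirst⟩
    · classical
      -- The least index of the class has finitely many redundant stages, so its follower born after
      -- the last of them is permanent.
      have hex : ∃ i, i ∈ A ∧ paths (V p) = paths (V i) := ⟨p, hp, rfl⟩
      obtain ⟨hqA, hq⟩ := Nat.find_spec hex
      set q := Nat.find hex with hq_def
      have hfin := finite_redundant V A hV (p := q) fun i hi hiA heq =>
        Nat.find_min hex hi ⟨hiA, hq.trans heq⟩
      obtain ⟨b, hb⟩ := hfin.bddAbove
      obtain ⟨t, htb, ht, hfirst⟩ := hbirth q (b + 1)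
      refine ⟨Sum.inl (q, t), ⟨hqA, ht⟩, ?_⟩
      simp only [hq]
      refine follower_of_forall_not V A fun s hs hr => ?_
      have : s ≤ b := hb hr
      exact hfirst s (by omega) hs hr

/-- The strings witnessing that a point lies outside the indexed classes. -/
def Escapes (V : ℕ → Set (List Bool)) (A : Set ℕ) (σ : List Bool) (j : ℕ × ℕ ⊕ List Bool) :
    Prop :=
  j.elim (fun q => (σ ∉ V q.1 ∧ ∀ s < σ.length, q.2 ≤ s → ¬ Redundant V A q.1 s) ∨
      ∃ s < σ.length + 1, FirstRedundant V A q.1 q.2 s ∧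
        (σ.length = (target V q.1 s).length ∧ σ ≠ target V q.1 s))
    (fun τ => σ.length = τ.length ∧ σ ≠ τ)

/-- A string removed while following must remain removed after a collapse. This holds because the
initial segment of length `s` of the target lies in the tree, so no string of length at most `s`
outside the tree is a prefix of the target. -/
theorem notMem_indexedClass_iff (hV : ∀ p, IsTree (V p)) (hne : ∀ p ∈ A, (paths (V p)).Nonempty)
    {j : ℕ × ℕ ⊕ List Bool} (hj : j ∈ indexSet V A) (X : Cantor) :
    X ∉ indexedClass V A j ↔ ∃ σ, Escapes V A σ j ∧ X ∈ cone σ := by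
  rcases j with ⟨p, t⟩ | τ
  · obtain ⟨hp, -⟩ := hj
    simp only at hp
    change X ∉ follower V A p t ↔ _
    by_cases h : ∀ s ≥ t, ¬ Redundant V A p s
    · rw [follower_of_forall_not V A h]
      constructor
      · intro hX
        obtain ⟨n, hn⟩ : ∃ n, initSeg X n ∉ V p := by simpa [paths] using hX
        exact ⟨initSeg X n, Or.inl ⟨hn, fun s _ hs => h s hs⟩, self_mem_cone_initSeg X n⟩
      · rintro ⟨σ, ⟨hσ, -⟩ | ⟨s, -, hs, -⟩, hXσ⟩ hX
        · have h1 : initSeg X σ.length = σ := hXσ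
          exact hσ (h1 ▸ hX σ.length)
        · exact h s hs.1 hs.2.1
    · push Not at h
      obtain ⟨s, hts, hr⟩ := h
      obtain ⟨s, hs⟩ := exists_firstRedundant V A hts hr
      obtain ⟨htV, htl⟩ := target_spec V p s (hne p hp)
      -- The target is at least as long as its stage, so the bounded search for `s` in `Escapes`
      -- finds the collapse from any string of the target's length.
      have hsl := Nat.right_le_pair p s
      rw [follower_of_firstRedundant V A hs]
      constructor
      · intro hX
        obtain ⟨σ, hσ, hXσ⟩ := mem_compl_cone_iff.1 hX
        exact ⟨σ, Or.inr ⟨s, by omega, hs, hσ⟩, hXσ⟩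
      · rintro ⟨σ, ⟨hσ, hfirst⟩ | ⟨s', -, hs', hσ⟩, hXσ⟩
        · intro hX
          have hle : σ.length ≤ s := by
            by_contra hlt
            exact hfirst s (by omega) hs.1 hs.2.1
          have h1 : initSeg X σ.length = σ := hXσ
          have h2 := initSeg_of_mem_cone hX (k := σ.length) (by omega)
          rw [h1, ← min_eq_left hle, ← List.take_take] at h2
          exact hσ (h2 ▸ (hV p).take_mem htV _)
        · rw [hs.unique hs']
          exact mem_compl_cone_iff.2 ⟨σ, hσ, hXσ⟩
  · exact mem_compl_cone_iff

/-! ### Effectiveness of the construction. -/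

section Primrec

variable {α : Type*} [Primcodable α]

theorem primrecPred_stageLE (hV : PrimrecPred fun q : ℕ × List Bool => q.2 ∈ V q.1)
    {p i r s : α → ℕ} (hp : Primrec p) (hi : Primrec i) (hr : Primrec r) (hs : Primrec s) :
    PrimrecPred fun a => StageLE (V (p a)) (V (i a)) (r a) (s a) := by
  refine primrecPred_forall_mem (primrec_strings.comp hs)
    (P := fun a σ => σ ∈ V (p a) → ∃ τ ∈ strings (s a), τ ∈ V (i a) ∧
      τ.take (r a) = σ.take (r a)) ?_
  refine primrecPred_imp (hV.comp ((hp.comp Primrec.fst).pair Primrec.snd)) ?_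
  refine primrecPred_exists_mem (primrec_strings.comp (hs.comp Primrec.fst))
    (P := fun (q : α × List Bool) τ => τ ∈ V (i q.1) ∧ τ.take (r q.1) = q.2.take (r q.1)) ?_
  have h1 : Primrec fun q : (α × List Bool) × List Bool => q.1.1 :=
    Primrec.fst.comp Primrec.fst
  exact (hV.comp ((hi.comp h1).pair Primrec.snd)).and (Primrec.eq.comp
    (Primrec.list_take.comp (hr.comp h1) Primrec.snd)
    (Primrec.list_take.comp (hr.comp h1) (Primrec.snd.comp Primrec.fst)))

theorem primrecPred_agree (hV : PrimrecPred fun q : ℕ × List Bool => q.2 ∈ V q.1)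
    {p i r s : α → ℕ} (hp : Primrec p) (hi : Primrec i) (hr : Primrec r) (hs : Primrec s) :
    PrimrecPred fun a => Agree (V (p a)) (V (i a)) (r a) (s a) :=
  (Primrec.nat_le.comp hr hs).and
    ((primrecPred_stageLE hV hp hi hr hs).and (primrecPred_stageLE hV hi hp hr hs))

theorem primrecPred_redundant (hV : PrimrecPred fun q : ℕ × List Bool => q.2 ∈ V q.1)
    (hA : PrimrecPred fun p => p ∈ A) {p s : α → ℕ} (hp : Primrec p) (hs : Primrec s) :
    PrimrecPred fun a => Redundant V A (p a) (s a) := by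
  refine primrecPred_exists_lt hp (P := fun a i => i ∈ A ∧ ∃ r < s a + 1,
    Agree (V (p a)) (V i) r (s a) ∧ ∀ s' < s a, ¬ Agree (V (p a)) (V i) r s') ?_
  refine (hA.comp Primrec.snd).and ?_
  refine primrecPred_exists_lt (Primrec.succ.comp (hs.comp Primrec.fst))
    (P := fun (q : α × ℕ) r => Agree (V (p q.1)) (V q.2) r (s q.1) ∧
      ∀ s' < s q.1, ¬ Agree (V (p q.1)) (V q.2) r s') ?_
  have h1 : Primrec fun q : (α × ℕ) × ℕ => q.1.1 := Primrec.fst.comp Primrec.fst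
  have h2 : Primrec fun q : (α × ℕ) × ℕ => q.1.2 := Primrec.snd.comp Primrec.fst
  refine (primrecPred_agree hV (hp.comp h1) h2 Primrec.snd (hs.comp h1)).and ?_
  refine primrecPred_forall_lt (hs.comp h1)
    (P := fun (q : (α × ℕ) × ℕ) s' => ¬ Agree (V (p q.1.1)) (V q.1.2) q.2 s') ?_
  exact (primrecPred_agree hV (hp.comp (h1.comp Primrec.fst)) (h2.comp Primrec.fst)
    (Primrec.snd.comp Primrec.fst) Primrec.snd).not

theorem primrecPred_firstRedundant (hV : PrimrecPred fun q : ℕ × List Bool => q.2 ∈ V q.1)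
    (hA : PrimrecPred fun p => p ∈ A) {p t s : α → ℕ} (hp : Primrec p) (ht : Primrec t)
    (hs : Primrec s) : PrimrecPred fun a => FirstRedundant V A (p a) (t a) (s a) := by
  refine (Primrec.nat_le.comp ht hs).and ((primrecPred_redundant hV hA hp hs).and ?_)
  refine primrecPred_forall_lt hs
    (P := fun a s' => t a ≤ s' → ¬ Redundant V A (p a) s') ?_
  exact primrecPred_imp (Primrec.nat_le.comp (ht.comp Primrec.fst) Primrec.snd)
    (primrecPred_redundant hV hA (hp.comp Primrec.fst) Primrec.snd).not

theorem primrec_target (hV : PrimrecPred fun q : ℕ × List Bool => q.2 ∈ V q.1)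
    {p s : α → ℕ} (hp : Primrec p) (hs : Primrec s) : Primrec fun a => target V (p a) (s a) := by
  classical
  refine Primrec.list_append.comp (Primrec.option_getD.comp (Primrec.list_head?.comp ?_)
    (Primrec.const [])) (primrec_replicate_false.comp (Primrec.nat_sub.comp
      (Primrec₂.natPair.comp hp hs) hs))
  exact primrec_filter (primrec_strings.comp hs) (P := fun a σ => σ ∈ V (p a))
    (hV.comp ((hp.comp Primrec.fst).pair Primrec.snd))

/-- A predicate on a sum is primitive recursive if both of its parts are. -/
theorem primrecPred_sumElim {β γ : Type*} [Primcodable β] [Primcodable γ]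
    {f : α → β ⊕ γ} (hf : Primrec f) {P : α → β → Prop} {Q : α → γ → Prop}
    (hP : PrimrecPred fun q : α × β => P q.1 q.2) (hQ : PrimrecPred fun q : α × γ => Q q.1 q.2) :
    PrimrecPred fun a => (f a).elim (P a) (Q a) := by
  classical
  have h := Primrec.sumCasesOn hf (hP.decide.to₂) (hQ.decide.to₂)
  refine Primrec.primrecPred (h.of_eq fun a => ?_)
  cases f a <;> exact decide_eq_decide.2 Iff.rfl

theorem primrecPred_indexSet (hV : PrimrecPred fun q : ℕ × List Bool => q.2 ∈ V q.1)
    (hA : PrimrecPred fun p => p ∈ A) : PrimrecPred fun j => j ∈ indexSet V A := by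
  refine primrecPred_sumElim Primrec.id
    (P := fun _ (q : ℕ × ℕ) => q.1 ∈ A ∧ (q.2 = 0 ∨ Redundant V A q.1 (q.2 - 1)))
    (Q := fun _ (τ : List Bool) => ¬ (τ.length.unpair.1 ∈ A ∧
      Redundant V A τ.length.unpair.1 τ.length.unpair.2 ∧
      τ = target V τ.length.unpair.1 τ.length.unpair.2)) ?_ ?_
  · have h1 : Primrec fun q : (ℕ × ℕ ⊕ List Bool) × (ℕ × ℕ) => q.2.1 :=
      Primrec.fst.comp Primrec.snd
    have h2 : Primrec fun q : (ℕ × ℕ ⊕ List Bool) × (ℕ × ℕ) => q.2.2 :=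
      Primrec.snd.comp Primrec.snd
    exact (hA.comp h1).and ((Primrec.eq.comp h2 (Primrec.const 0)).or
      (primrecPred_redundant hV hA h1 (Primrec.nat_sub.comp h2 (Primrec.const 1))))
  · have hu : Primrec fun q : (ℕ × ℕ ⊕ List Bool) × List Bool => q.2.length.unpair :=
      Primrec.unpair.comp (Primrec.list_length.comp Primrec.snd)
    have h1 := Primrec.fst.comp hu
    have h2 := Primrec.snd.comp hu
    exact ((hA.comp h1).and ((primrecPred_redundant hV hA h1 h2).and
      (Primrec.eq.comp Primrec.snd (primrec_target hV h1 h2)))).not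

theorem primrecPred_escapes (hV : PrimrecPred fun q : ℕ × List Bool => q.2 ∈ V q.1)
    (hA : PrimrecPred fun p => p ∈ A) :
    PrimrecPred fun q : List Bool × (ℕ × ℕ ⊕ List Bool) => Escapes V A q.1 q.2 := by
  refine primrecPred_sumElim Primrec.snd
    (P := fun (a : List Bool × (ℕ × ℕ ⊕ List Bool)) q =>
      (a.1 ∉ V q.1 ∧ ∀ s < a.1.length, q.2 ≤ s → ¬ Redundant V A q.1 s) ∨
      ∃ s < a.1.length + 1, FirstRedundant V A q.1 q.2 s ∧
        (a.1.length = (target V q.1 s).length ∧ a.1 ≠ target V q.1 s))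
    (Q := fun a τ => a.1.length = τ.length ∧ a.1 ≠ τ) ?_ ?_
  · have h0 : Primrec fun q : (List Bool × (ℕ × ℕ ⊕ List Bool)) × (ℕ × ℕ) => q.1.1 :=
      Primrec.fst.comp Primrec.fst
    have h1 : Primrec fun q : (List Bool × (ℕ × ℕ ⊕ List Bool)) × (ℕ × ℕ) => q.2.1 :=
      Primrec.fst.comp Primrec.snd
    have h2 : Primrec fun q : (List Bool × (ℕ × ℕ ⊕ List Bool)) × (ℕ × ℕ) => q.2.2 :=
      Primrec.snd.comp Primrec.snd
    have hl := Primrec.list_length.comp h0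
    refine ((hV.comp (h1.pair h0)).not.and ?_).or ?_
    · refine primrecPred_forall_lt hl (P := fun q s => q.2.2 ≤ s → ¬ Redundant V A q.2.1 s) ?_
      exact primrecPred_imp (Primrec.nat_le.comp (h2.comp Primrec.fst) Primrec.snd)
        (primrecPred_redundant hV hA (h1.comp Primrec.fst) Primrec.snd).not
    · refine primrecPred_exists_lt (Primrec.succ.comp hl)
        (P := fun q s => FirstRedundant V A q.2.1 q.2.2 s ∧
          (q.1.1.length = (target V q.2.1 s).length ∧ q.1.1 ≠ target V q.2.1 s)) ?_
      have ht := primrec_target hV (h1.comp Primrec.fst) (Primrec.snd (β := ℕ))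
      exact (primrecPred_firstRedundant hV hA (h1.comp Primrec.fst) (h2.comp Primrec.fst)
        Primrec.snd).and ((Primrec.eq.comp (hl.comp Primrec.fst) (Primrec.list_length.comp ht)).and
          (Primrec.eq.comp (h0.comp Primrec.fst) ht).not)
  · have h0 : Primrec fun q : (List Bool × (ℕ × ℕ ⊕ List Bool)) × List Bool => q.1.1 :=
      Primrec.fst.comp Primrec.fst
    exact (Primrec.eq.comp (Primrec.list_length.comp h0)
      (Primrec.list_length.comp Primrec.snd)).and (Primrec.eq.comp h0 Primrec.snd).not

end Primrec

/-- A primitive recursive sequence of classes that are neither empty nor cones, together with all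
cones, has an injective effective numbering. -/
theorem exists_injective_numbering (hVt : ∀ p, IsTree (V p))
    (hV : PrimrecPred fun q : ℕ × List Bool => q.2 ∈ V q.1) (hA : PrimrecPred fun p => p ∈ A)
    (hne : ∀ p ∈ A, (paths (V p)).Nonempty) (hcone : ∀ p ∈ A, ∀ τ, paths (V p) ≠ cone τ) :
    ∃ G : ℕ → Set Cantor, Function.Injective G ∧
      Set.range G = Set.range cone ∪ (fun p => paths (V p)) '' A ∧
      IsPi01Rel {p | p.1 ∈ G p.2} := by
  have himg := image_indexedClass (A := A) hVt
  rw [← himg]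
  refine exists_renumbering (primrecPred_indexSet hV hA) ?_
    (injOn_indexedClass hVt hne hcone) (primrecPred_escapes hV hA)
    fun j hj X => notMem_indexedClass_iff hVt hne hj X
  refine Set.Infinite.of_image (indexedClass V A) ?_
  rw [himg]
  exact (Set.infinite_range_of_injective cone_injective).mono Set.subset_union_left

end Kummer

/-! ### Guarded trees: positive measure and not a cone, by construction. -/

section Guarded

variable (T : Set (List Bool)) (ρ : List Bool) (n s₀ : ℕ)

open Classical in
/-- The strings of length `s` in `T` cover measure at least `2⁻ⁿ`, they branch at `ρ`, and they
miss some extension of `ρ`. -/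
def GoodLevel (s : ℕ) : Prop :=
  (∃ γ ∈ strings s, γ.take ρ.length = ρ ∧ γ ∉ T) ∧
    (∀ b ∈ [false, true], ∃ σ ∈ strings s, σ ∈ T ∧ σ.take (ρ.length + 1) = ρ ++ [b]) ∧
    2 ^ s ≤ 2 ^ n * ((strings s).filter (· ∈ T)).length

/-- The tree `T`, left to branch fully from the first level after `s₀` that is not good. -/
def guarded : Set (List Bool) :=
  {σ | ∀ k < σ.length + 1, (∀ s < k + 1, s₀ ≤ s → GoodLevel T ρ n s) → σ.take k ∈ T}

theorem isTree_guarded : IsTree (guarded T ρ n s₀) := by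
  intro σ τ h hτ k hk hs
  have hl : σ.length ≤ τ.length := h.length_le
  have ht : σ.take k = τ.take k := by
    rw [List.prefix_iff_eq_take.1 h, List.take_take, min_eq_left (by omega)]
  rw [ht]
  exact hτ k (by omega) hs

theorem mem_paths_guarded {X : Cantor} : X ∈ paths (guarded T ρ n s₀) ↔
    ∀ k, (∀ s < k + 1, s₀ ≤ s → GoodLevel T ρ n s) → initSeg X k ∈ T := by
  constructor
  · intro h k hk
    have := h k k (by simp) hk
    rwa [take_initSeg X le_rfl] at this
  · intro h m k hk hs
    rw [length_initSeg] at hk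
    rw [take_initSeg X (by omega)]
    exact h k hs

theorem paths_guarded_of_forall (h : ∀ s ≥ s₀, GoodLevel T ρ n s) :
    paths (guarded T ρ n s₀) = paths T := by
  ext X
  rw [mem_paths_guarded]
  exact ⟨fun hX k => hX k fun s _ hs => h s hs, fun hX k _ => hX k⟩

variable {T ρ n s₀}

/-- Let `m` be the first bad level from `s₀` on. Only levels below `m` constrain the tree, and since
`s₀` is good, the last of these, `m - 1`, is still at least `s₀` and hence good. -/
theorem paths_guarded_of_exists_not (hT : IsTree T) (h₀ : GoodLevel T ρ n s₀)
    (h : ∃ s ≥ s₀, ¬ GoodLevel T ρ n s) :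
    ∃ l, GoodLevel T ρ n l ∧ paths (guarded T ρ n s₀) = {X | initSeg X l ∈ T} := by
  classical
  obtain ⟨hm, hbad⟩ := Nat.find_spec h
  have hmin : ∀ s < Nat.find h, s₀ ≤ s → GoodLevel T ρ n s := fun s hs h1 => by
    by_contra h2
    exact Nat.find_min h hs ⟨h1, h2⟩
  generalize Nat.find h = m at *
  have hlt : s₀ < m := lt_of_le_of_ne hm fun heq => hbad (heq ▸ h₀)
  refine ⟨m - 1, hmin _ (by omega) (by omega), ?_⟩
  ext X
  rw [mem_paths_guarded]
  constructor
  · exact fun hX => hX (m - 1) fun s hs h1 => hmin s (by omega) h1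
  · intro hX k hk
    refine hT.initSeg_mem hX ?_
    by_contra hlk
    exact hbad (hk m (by omega) hm)

theorem exists_initSeg_mem_of_goodLevel {s : ℕ} (h : GoodLevel T ρ n s) (b : Bool) :
    ∃ σ ∈ T, σ.length = s ∧ σ.take (ρ ++ [b]).length = ρ ++ [b] := by
  obtain ⟨σ, hl, hσ, ht⟩ := h.2.1 b (by cases b <;> simp)
  exact ⟨σ, hσ, by simpa using hl, by simpa using ht⟩

theorem exists_mem_paths_guarded (hT : IsTree T) (h₀ : GoodLevel T ρ n s₀) (b : Bool) :
    ∃ X ∈ paths (guarded T ρ n s₀), X ∈ cone (ρ ++ [b]) := by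
  by_cases h : ∀ s ≥ s₀, GoodLevel T ρ n s
  · rw [paths_guarded_of_forall T ρ n s₀ h]
    refine hT.exists_path _ fun N => ⟨max N s₀, le_max_left _ _, ?_⟩
    exact exists_initSeg_mem_of_goodLevel (h _ (le_max_right _ _)) b
  · push Not at h
    obtain ⟨l, hl, hP⟩ := paths_guarded_of_exists_not hT h₀ h
    rw [hP]
    obtain ⟨σ, hσ, rfl, ht⟩ := exists_initSeg_mem_of_goodLevel hl b
    refine ⟨extendZero σ, ?_, ht ▸ mem_cone_take _ (extendZero_mem_cone σ)⟩
    have h1 : initSeg (extendZero σ) σ.length = σ := extendZero_mem_cone σ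
    change initSeg (extendZero σ) σ.length ∈ T
    rwa [h1]

/-- The bound `2⁻ⁿ` survives in both cases: by continuity from above if all levels are good, and at
the last good level otherwise. -/
theorem coinMeasure_paths_guarded_pos (hT : IsTree T) (h₀ : GoodLevel T ρ n s₀) :
    0 < coinMeasure (paths (guarded T ρ n s₀)) := by
  have hpos : (0 : ENNReal) < (2 ^ n)⁻¹ := by simp
  refine hpos.trans_le ?_
  by_cases h : ∀ s ≥ s₀, GoodLevel T ρ n s
  · rw [paths_guarded_of_forall T ρ n s₀ h]
    have hint : paths T = ⋂ k, {X | initSeg X k ∈ T} := by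
      ext X
      simp [paths]
    have hanti : Antitone fun k => {X | initSeg X k ∈ T} :=
      fun k l hkl X hX => hT.initSeg_mem hX hkl
    rw [hint, hanti.measure_iInter
      (fun k => (isClopen_setOf_initSeg T k).1.measurableSet.nullMeasurableSet)
      ⟨0, measure_ne_top _ _⟩]
    refine le_iInf fun k => ?_
    refine le_trans ?_ (measure_mono (hanti (le_max_left k s₀)))
    exact (inv_two_pow_le_coinMeasure_iff T n _).2 (h _ (le_max_right _ _)).2.2
  · push Not at h
    obtain ⟨l, hl, hP⟩ := paths_guarded_of_exists_not hT h₀ h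
    rw [hP]
    exact (inv_two_pow_le_coinMeasure_iff T n l).2 hl.2.2

/-- Branching at `ρ` forces `τ` to be a prefix of `ρ`; the cone would then contain every extension
of `ρ`, including the one missing at level `s₀`. -/
theorem paths_guarded_ne_cone (hT : IsTree T) (h₀ : GoodLevel T ρ n s₀) (τ : List Bool) :
    paths (guarded T ρ n s₀) ≠ cone τ := by
  intro heq
  obtain ⟨X, hX, hXρ⟩ := exists_mem_paths_guarded hT h₀ false
  obtain ⟨Y, hY, hYρ⟩ := exists_mem_paths_guarded hT h₀ true
  rw [heq] at hX hY
  have hle : τ.length ≤ ρ.length := by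
    by_contra hlt
    have h1 := mem_cone_iff_getElem.1 hX ρ.length (by omega)
    have h2 := mem_cone_iff_getElem.1 hY ρ.length (by omega)
    have h3 := mem_cone_iff_getElem.1 hXρ ρ.length (by simp)
    have h4 := mem_cone_iff_getElem.1 hYρ ρ.length (by simp)
    rw [← h2, h4] at h1
    rw [h3] at h1
    simp at h1
  have hτ : τ = ρ.take τ.length := by
    have h1 : initSeg X τ.length = τ := hX
    have h2 := initSeg_of_mem_cone hXρ (k := τ.length) (by simp; omega)
    rw [h1, List.take_append_of_le_length hle] at h2
    exact h2
  obtain ⟨γ, hγl, hγρ, hγ⟩ := h₀.1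
  rw [mem_strings] at hγl
  have hmem : extendZero γ ∈ paths (guarded T ρ n s₀) := by
    rw [heq, hτ, ← hγρ]
    exact mem_cone_take _ (mem_cone_take _ (extendZero_mem_cone γ))
  have h5 := (mem_paths_guarded T ρ n s₀).1 hmem s₀ fun s hs h1 => by
    have : s = s₀ := by omega
    rwa [this]
  have h6 : initSeg (extendZero γ) γ.length = γ := extendZero_mem_cone γ
  rw [← hγl, h6] at h5
  exact hγ h5

/-- Every class of positive measure that is not a cone is left alone by suitable parameters. -/
theorem exists_goodLevel (hpos : 0 < coinMeasure (paths T)) (hT : IsTree T)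
    (hcone : ∀ τ, paths T ≠ cone τ) : ∃ ρ n s₀, ∀ s ≥ s₀, GoodLevel T ρ n s := by
  classical
  obtain ⟨n, hn⟩ := ENNReal.exists_inv_two_pow_lt hpos.ne'
  rw [← ENNReal.inv_pow] at hn
  -- `ρ` is the stem of the class. Without one, the class would lie in a cone of length `n`, of
  -- measure `2⁻ⁿ`, contradicting the choice of `n`.
  obtain ⟨ρ, hρ, hmax⟩ : ∃ ρ, paths T ⊆ cone ρ ∧ ∀ b, ¬ paths T ⊆ cone (ρ ++ [b]) := by
    by_contra! hcon
    have hall : ∀ k, ∃ ρ : List Bool, ρ.length = k ∧ paths T ⊆ cone ρ := by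
      intro k
      induction k with
      | zero => exact ⟨[], rfl, fun X _ => by simp [cone, initSeg]⟩
      | succ k ih =>
        obtain ⟨ρ, hl, hρ⟩ := ih
        obtain ⟨b, hb⟩ := hcon ρ hρ
        exact ⟨ρ ++ [b], by simp [hl], hb⟩
    obtain ⟨ρ, hl, hρ⟩ := hall n
    have h1 := measure_mono (μ := coinMeasure) hρ
    rw [coinMeasure_cone, hl] at h1
    exact absurd hn (not_lt.2 h1)
  have hbranch : ∀ b, ∃ X ∈ paths T, X ∈ cone (ρ ++ [b]) := by
    intro b
    obtain ⟨X, hX, hXb⟩ := Set.not_subset.1 (hmax !b)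
    refine ⟨X, hX, ?_⟩
    have h1 := mem_cone_iff_getElem.1 (hρ hX)
    rw [mem_cone_iff_getElem] at hXb ⊢
    have hXρ : X ρ.length = b := by
      by_contra hne
      refine hXb fun i hi => ?_
      rw [List.length_append, List.length_singleton] at hi
      rcases Nat.lt_succ_iff_lt_or_eq.1 hi with h | rfl
      · rw [List.getElem_append_left h, h1 i h]
      · simpa using Bool.eq_not.2 hne
    intro i hi
    rw [List.length_append, List.length_singleton] at hi
    rcases Nat.lt_succ_iff_lt_or_eq.1 hi with h | rfl
    · rw [List.getElem_append_left h, h1 i h]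
    · simpa using hXρ
  obtain ⟨Y, hY, hYT⟩ := Set.not_subset.1 fun h => hcone ρ (hρ.antisymm h)
  obtain ⟨k, hk⟩ : ∃ k, initSeg Y k ∉ T := by simpa [paths] using hYT
  -- From this level on, `Y` has left `T` and strings are long enough to show the bit after `ρ`.
  refine ⟨ρ, n, k + ρ.length + 1, fun s hs => ⟨?_, ?_, ?_⟩⟩
  · refine ⟨initSeg Y s, by simp, ?_, fun h => hk (hT.initSeg_mem h (by omega))⟩
    rw [take_initSeg Y (by omega)]
    exact hY
  · intro b _
    obtain ⟨X, hX, hXb⟩ := hbranch b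
    refine ⟨initSeg X s, by simp, hX s, ?_⟩
    have h1 : initSeg X (ρ ++ [b]).length = ρ ++ [b] := hXb
    rw [take_initSeg X (by omega)]
    simpa using h1
  · rw [← inv_two_pow_le_coinMeasure_iff]
    exact hn.le.trans (measure_mono fun X hX => hX s)

end Guarded

/-! ### The uniform listing of guarded trees. -/

/-- Parameters of guarded trees: a program, a branching string, a bound on the measure, and a
level. -/
abbrev Param : Type := Nat.Partrec.Code × List Bool × ℕ × ℕ

/-- The parameters coded by a number. -/
def param (p : ℕ) : Param :=
  (Encodable.decode p : Option Param).getD (Nat.Partrec.Code.zero, [], 0, 0)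

theorem primrec_param : Primrec param :=
  Primrec.option_getD.comp Primrec.decode (Primrec.const _)

theorem param_encode (q : Param) : param (Encodable.encode q) = q := by
  simp [param]

/-- The guarded tree with index `p`. -/
def guardedTree (p : ℕ) : Set (List Bool) :=
  guarded (codeTree (param p).1) (param p).2.1 (param p).2.2.1 (param p).2.2.2

/-- The indices of guarded trees whose initial level is good. -/
def goodIndices : Set ℕ :=
  {p | GoodLevel (codeTree (param p).1) (param p).2.1 (param p).2.2.1 (param p).2.2.2}

section Primrec

variable {α : Type*} [Primcodable α]

theorem primrecPred_goodLevel {c : α → Nat.Partrec.Code} {ρ : α → List Bool} {n s : α → ℕ}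
    (hc : Primrec c) (hρ : Primrec ρ) (hn : Primrec n) (hs : Primrec s) :
    PrimrecPred fun a => GoodLevel (codeTree (c a)) (ρ a) (n a) (s a) := by
  classical
  have hl := Primrec.list_length.comp hρ
  have hmem : PrimrecPred fun q : α × List Bool => q.2 ∈ codeTree (c q.1) :=
    primrecPred_codeTree.comp ((hc.comp Primrec.fst).pair Primrec.snd)
  refine PrimrecPred.and ?_ (PrimrecPred.and ?_ ?_)
  · refine primrecPred_exists_mem (primrec_strings.comp hs)
      (P := fun a γ => γ.take (ρ a).length = ρ a ∧ γ ∉ codeTree (c a)) ?_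
    exact (Primrec.eq.comp (Primrec.list_take.comp (hl.comp Primrec.fst) Primrec.snd)
      (hρ.comp Primrec.fst)).and hmem.not
  · refine primrecPred_forall_mem (Primrec.const [false, true]) (P := fun a b =>
      ∃ σ ∈ strings (s a), σ ∈ codeTree (c a) ∧ σ.take ((ρ a).length + 1) = ρ a ++ [b]) ?_
    refine primrecPred_exists_mem (primrec_strings.comp (hs.comp Primrec.fst))
      (P := fun (q : α × Bool) σ => σ ∈ codeTree (c q.1) ∧
        σ.take ((ρ q.1).length + 1) = ρ q.1 ++ [q.2]) ?_
    have h1 : Primrec fun q : (α × Bool) × List Bool => q.1.1 := Primrec.fst.comp Primrec.fst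
    refine (hmem.comp (h1.pair Primrec.snd)).and (Primrec.eq.comp
      (Primrec.list_take.comp (Primrec.succ.comp (hl.comp h1)) Primrec.snd)
      (Primrec.list_append.comp (hρ.comp h1) (Primrec.list_cons.comp
        (Primrec.snd.comp Primrec.fst) (Primrec.const []))))
  · exact Primrec.nat_le.comp (primrec_two_pow.comp hs) (Primrec.nat_mul.comp
      (primrec_two_pow.comp hn) (Primrec.list_length.comp
        (primrec_filter (primrec_strings.comp hs) (P := fun a σ => σ ∈ codeTree (c a)) hmem)))

theorem primrecPred_goodIndices : PrimrecPred fun p => p ∈ goodIndices :=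
  have h := primrec_param
  primrecPred_goodLevel (Primrec.fst.comp h) (Primrec.fst.comp (Primrec.snd.comp h))
    (Primrec.fst.comp (Primrec.snd.comp (Primrec.snd.comp h)))
    (Primrec.snd.comp (Primrec.snd.comp (Primrec.snd.comp h)))

theorem primrecPred_guardedTree :
    PrimrecPred fun q : ℕ × List Bool => q.2 ∈ guardedTree q.1 := by
  refine primrecPred_forall_lt (Primrec.succ.comp (Primrec.list_length.comp Primrec.snd))
    (P := fun (q : ℕ × List Bool) k => (∀ s < k + 1, (param q.1).2.2.2 ≤ s →
      GoodLevel (codeTree (param q.1).1) (param q.1).2.1 (param q.1).2.2.1 s) →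
      q.2.take k ∈ codeTree (param q.1).1) ?_
  have h : Primrec fun q : (ℕ × List Bool) × ℕ => param q.1.1 :=
    primrec_param.comp (Primrec.fst.comp Primrec.fst)
  refine primrecPred_imp ?_ (primrecPred_codeTree.comp ((Primrec.fst.comp h).pair
    (Primrec.list_take.comp Primrec.snd (Primrec.snd.comp Primrec.fst))))
  refine primrecPred_forall_lt (Primrec.succ.comp Primrec.snd)
    (P := fun (q : (ℕ × List Bool) × ℕ) s => (param q.1.1).2.2.2 ≤ s →
      GoodLevel (codeTree (param q.1.1).1) (param q.1.1).2.1 (param q.1.1).2.2.1 s) ?_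
  have h' := h.comp (Primrec.fst (β := ℕ))
  exact primrecPred_imp
    (Primrec.nat_le.comp (Primrec.snd.comp (Primrec.snd.comp (Primrec.snd.comp h'))) Primrec.snd)
    (primrecPred_goodLevel (Primrec.fst.comp h') (Primrec.fst.comp (Primrec.snd.comp h'))
      (Primrec.fst.comp (Primrec.snd.comp (Primrec.snd.comp h'))) Primrec.snd)

end Primrec

/-! ### The Friedberg numbering and its dual form. -/

theorem exists_friedbergNumbering_positivePi01Classes :
    ∃ F : ℕ → Set Cantor, IsFriedbergNumbering IsPi01Rel positivePi01Classes F := by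
  obtain ⟨G, hinj, hrange, hrel⟩ := exists_injective_numbering
    (V := guardedTree) (A := goodIndices) (fun p => isTree_guarded _ _ _ _)
    primrecPred_guardedTree primrecPred_goodIndices
    (fun p hp => (exists_mem_paths_guarded (isTree_codeTree _) hp false).imp fun _ h => h.1)
    (fun p hp => paths_guarded_ne_cone (isTree_codeTree _) hp)
  refine ⟨G, ⟨Set.Subset.antisymm ?_ ?_, hrel⟩, hinj⟩
  · rintro _ ⟨e, rfl⟩
    refine ⟨isPi01Class_of_rel hrel e, ?_⟩
    have he : G e ∈ Set.range G := ⟨e, rfl⟩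
    rw [hrange] at he
    rcases he with ⟨τ, hτ⟩ | ⟨p, hp, hP⟩
    · rw [← hτ, coinMeasure_cone]
      simp
    · rw [← hP]
      exact coinMeasure_paths_guarded_pos (isTree_codeTree _) hp
  · rintro P ⟨hP, hpos⟩
    rw [hrange]
    by_cases hcone : ∃ τ, P = cone τ
    · obtain ⟨τ, rfl⟩ := hcone
      exact Or.inl ⟨τ, rfl⟩
    · push Not at hcone
      obtain ⟨c, hc⟩ := exists_paths_codeTree_eq (isPi01Class_iff_compl.1 hP)
      rw [compl_compl] at hc
      subst hc
      obtain ⟨ρ, n, s₀, hgood⟩ := exists_goodLevel hpos (isTree_codeTree c) hcone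
      refine Or.inr ⟨Encodable.encode ((c, ρ, n, s₀) : Param), ?_, ?_⟩
      -- Admission to `goodIndices` tests only level `s₀`, which makes it decidable; that all later
      -- levels are good ensures that the guard never acts.
      · simp only [goodIndices, Set.mem_ofPred_eq, param_encode]
        exact hgood s₀ le_rfl
      · simp only [guardedTree, param_encode]
        exact paths_guarded_of_forall _ _ _ _ hgood

/-- Path classes are closed, hence measurable, so in a probability space the complement has full
measure exactly when the class is null. -/
theorem mem_positivePi01Classes_iff_compl {P : Set Cantor} :
    P ∈ positivePi01Classes ↔ Pᶜ ∈ nonfullSigma01Classes := by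
  refine and_congr_right_iff.2 ?_ |>.trans (and_congr_left_iff.2 fun _ => isPi01Class_iff_compl)
  rintro ⟨T, -, -, rfl⟩
  rw [pos_iff_ne_zero, prob_le_one.lt_iff_ne, Ne, Ne,
    prob_compl_eq_one_iff (isClosed_paths T).measurableSet]

theorem isFriedbergNumbering_iff_compl (F : ℕ → Set Cantor) :
    IsFriedbergNumbering IsPi01Rel positivePi01Classes F ↔
      IsFriedbergNumbering IsSigma01Rel nonfullSigma01Classes fun e => (F e)ᶜ := by
  have hinj : Function.Injective (fun e => (F e)ᶜ) ↔ Function.Injective F :=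
    compl_injective.of_comp_iff F
  have hrange : Set.range F = positivePi01Classes ↔
      Set.range (fun e => (F e)ᶜ) = nonfullSigma01Classes := by
    have h1 : Set.range (fun e => (F e)ᶜ) = compl '' Set.range F := Set.range_comp compl F
    have h2 : nonfullSigma01Classes = compl '' positivePi01Classes := by
      ext U
      rw [Set.mem_compl_image, mem_positivePi01Classes_iff_compl, compl_compl]
    rw [h1, h2, compl_injective.image_injective.eq_iff]
  unfold IsFriedbergNumbering IsEffectiveNumbering IsNumbering
  rw [hinj, hrange]
  rfl

end CantorClasses

theorem mainTheorem2 :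
    (∃ F : ℕ → Set CantorClasses.Cantor,
      CantorClasses.IsFriedbergNumbering CantorClasses.IsPi01Rel
        CantorClasses.positivePi01Classes F) ∧
    (∃ G : ℕ → Set CantorClasses.Cantor,
      CantorClasses.IsFriedbergNumbering CantorClasses.IsSigma01Rel
        CantorClasses.nonfullSigma01Classes G) ∧
    (∀ F : ℕ → Set CantorClasses.Cantor,
      CantorClasses.IsFriedbergNumbering CantorClasses.IsPi01Rel
          CantorClasses.positivePi01Classes F ↔
        CantorClasses.IsFriedbergNumbering CantorClasses.IsSigma01Rel
          CantorClasses.nonfullSigma01Classes (fun e => (F e)ᶜ)) := by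
  obtain ⟨F, hF⟩ := CantorClasses.exists_friedbergNumbering_positivePi01Classes
  exact ⟨⟨F, hF⟩, ⟨_, (CantorClasses.isFriedbergNumbering_iff_compl F).1 hF⟩,
    CantorClasses.isFriedbergNumbering_iff_compl⟩
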